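/- Let $b_1,b_2\ge 0$ be integers, not both zero, let $\sigma>0$ and $P'\ge 0$, and let $0=q_0<q_1<\dots<q_{2^{b_2}}=\infty$ be magnitude thresholds. Consider the channel $Z=U+N$ with complex input $U$ and independent circularly symmetric complex Gaussian noise $N$ with $\mathbb{E}|N|^2=\sigma^2$, i.e. with density $\frac{1}{\pi\sigma^2}e^{-|z|^2/\sigma^2}$ on $\mathbb{C}$. The output is the pair $(Y_1,Y_2)$, where $Y_1=y_1\in\{0,\dots,2^{b_1}-1\}$ when the phase of $Z$ (taken in $[-\pi,\pi)$) lies in $\left[\frac{2\pi y_1}{2^{b_1}}-\pi,\frac{2\pi (y_1+1)}{2^{b_1}}-\pi\right)$, and $Y_2=y_2\in\{0,\dots,2^{b_2}-1\}$ when $q_{y_2}\le |Z|<q_{y_2+1}$. For $u\in\mathbb{C}$ put $W_{y_1,y_2}(u)=\Pr(Y_1=y_1,Y_2=y_2\mid U=u)$, and for a Borel probability measure $F$ on $\mathbb{C}$ put $p(y_1,y_2;F)=\int_{\mathbb{C}} W_{y_1,y_2}\,dF$ and $$I(F)=-\int_{\mathbb{C}}\sum_{y_1,y_2}W_{y_1,y_2}(u)\log_2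 p(y_1,y_2;F)\,dF(u)+\int_{\mathbb{C}}\sum_{y_1,y_2}W_{y_1,y_2}(u)\log_2 W_{y_1,y_2}(u)\,dF(u),$$ the mutual information between $U\sim F$ and $(Y_1,Y_2)$. Let $\Omega$ be the set of Borel probability measures $F$ on $\mathbb{C}$ with $\int_{\mathbb{C}}|u|^2\,dF(u)\le P'$, and let $C=\sup_{F\in\Omega}I(F)$ be the capacity. Then every capacity-achieving input distribution, i.e. every $F_U^*\in\Omega$ with $I(F_U^*)=C$, has bounded support. -/

import Mathlib

open MeasureTheory
open scoped ENNReal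

noncomputable section

namespace PolarQuantization

/-- Law of `Z = u + N`, where `N` is circularly symmetric complex Gaussian noise with
`E|N|² = σ²`: its density with respect to area is `(πσ²)⁻¹ exp(-|z - u|²/σ²)`. -/
def receivedLaw (σ : ℝ) (u : ℂ) : Measure ℂ :=
  volume.withDensity fun z =>
    ENNReal.ofReal (1 / (Real.pi * σ ^ 2) * Real.exp (-(‖z - u‖ ^ 2 / σ ^ 2)))

/-- Points that the `b₁`-bit phase quantizer maps to `y₁`: the phase, taken in `[-π, π)`, lies in
`[2πy₁/2^b₁ - π, 2π(y₁+1)/2^b₁ - π)`. -/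
def phaseRegion (b₁ : ℕ) (y₁ : Fin (2 ^ b₁)) : Set ℂ :=
  {z | toIcoMod Real.two_pi_pos (-Real.pi) z.arg ∈
    Set.Ico (2 * Real.pi / 2 ^ b₁ * (y₁ : ℕ) - Real.pi)
      (2 * Real.pi / 2 ^ b₁ * ((y₁ : ℕ) + 1) - Real.pi)}

/-- `q` is a valid list of magnitude thresholds `0 = q₀ < q₁ < ⋯ < q_{2^b₂} = ∞`. -/
structure IsThresholds (b₂ : ℕ) (q : Fin (2 ^ b₂ + 1) → ℝ≥0∞) : Prop where
  zero : q 0 = 0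
  last : q (Fin.last (2 ^ b₂)) = ⊤
  strictMono : StrictMono q

/-- Points that the `b₂`-bit magnitude quantizer maps to `y₂`: `q_{y₂} ≤ |z| < q_{y₂+1}`. -/
def magnitudeRegion (b₂ : ℕ) (q : Fin (2 ^ b₂ + 1) → ℝ≥0∞) (y₂ : Fin (2 ^ b₂)) : Set ℂ :=
  {z | q y₂.castSucc ≤ ‖z‖ₑ ∧ ‖z‖ₑ < q y₂.succ}

/-- The transition probability `W_{y₁,y₂}(u) = P(Y₁ = y₁, Y₂ = y₂ | U = u)`. -/
def W (σ : ℝ) (b₁ b₂ : ℕ) (q : Fin (2 ^ b₂ + 1) → ℝ≥0∞)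
    (y₁ : Fin (2 ^ b₁)) (y₂ : Fin (2 ^ b₂)) (u : ℂ) : ℝ :=
  (receivedLaw σ u).real (phaseRegion b₁ y₁ ∩ magnitudeRegion b₂ q y₂)

/-- The output PMF `p(y₁, y₂; F)` induced by the input distribution `F`. -/
def outputPMF (σ : ℝ) (b₁ b₂ : ℕ) (q : Fin (2 ^ b₂ + 1) → ℝ≥0∞) (F : ProbabilityMeasure ℂ)
    (y₁ : Fin (2 ^ b₁)) (y₂ : Fin (2 ^ b₂)) : ℝ :=
  ∫ u, W σ b₁ b₂ q y₁ y₂ u ∂(F : Measure ℂ)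

/-- The output entropy `H(Y₁, Y₂)`, in bits. -/
def outputEntropy (σ : ℝ) (b₁ b₂ : ℕ) (q : Fin (2 ^ b₂ + 1) → ℝ≥0∞)
    (F : ProbabilityMeasure ℂ) : ℝ :=
  -∫ u, ∑ y₁, ∑ y₂, W σ b₁ b₂ q y₁ y₂ u * Real.logb 2 (outputPMF σ b₁ b₂ q F y₁ y₂)
    ∂(F : Measure ℂ)

/-- The conditional entropy `H(Y₁, Y₂ | U)`, in bits. -/
def conditionalEntropy (σ : ℝ) (b₁ b₂ : ℕ) (q : Fin (2 ^ b₂ + 1) → ℝ≥0∞)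
    (F : ProbabilityMeasure ℂ) : ℝ :=
  -∫ u, ∑ y₁, ∑ y₂, W σ b₁ b₂ q y₁ y₂ u * Real.logb 2 (W σ b₁ b₂ q y₁ y₂ u) ∂(F : Measure ℂ)

/-- The mutual information `I(F) = I(U; Y₁, Y₂)` for `U ∼ F`. -/
def mutualInformation (σ : ℝ) (b₁ b₂ : ℕ) (q : Fin (2 ^ b₂ + 1) → ℝ≥0∞)
    (F : ProbabilityMeasure ℂ) : ℝ :=
  outputEntropy σ b₁ b₂ q F - conditionalEntropy σ b₁ b₂ q F

/-- The set `Ω` of input distributions with average power `E|U|² ≤ P'`. -/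
def admissibleInputs (P' : ℝ) : Set (ProbabilityMeasure ℂ) :=
  {F | ∫⁻ u, ‖u‖ₑ ^ 2 ∂(F : Measure ℂ) ≤ ENNReal.ofReal P'}

/-- The capacity `C = sup_{F ∈ Ω} I(F)`, as a supremum in the extended reals. -/
def capacity (σ : ℝ) (b₁ b₂ : ℕ) (q : Fin (2 ^ b₂ + 1) → ℝ≥0∞) (P' : ℝ) : EReal :=
  ⨆ F ∈ admissibleInputs P', (mutualInformation σ b₁ b₂ q F : EReal)

/-- `F` is capacity-achieving: it is admissible and `I(F) = C`. -/
def IsCapacityAchieving (σ : ℝ) (b₁ b₂ : ℕ) (q : Fin (2 ^ b₂ + 1) → ℝ≥0∞) (P' : ℝ)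
    (F : ProbabilityMeasure ℂ) : Prop :=
  F ∈ admissibleInputs P' ∧ (mutualInformation σ b₁ b₂ q F : EReal) = capacity σ b₁ b₂ q P'

end PolarQuantization

end

/-! Write `p` for the output law of an optimal `F`, `C` for its information in nats, and `D(u)` for
the relative entropy of the output law given `u` with respect to `p`. Moving from `F` towards an
admissible `G` cannot help, so the mean of `D` under `G` is at most `C`
(`integral_relEntropy_le_natInfo`). Testing this on two-point `G` gives a multiplier `m ≥ 0` with
`D(u) ≤ C + m(|u|² - P')` for all `u` (`exists_multiplier`). Since `D` has mean `C` under `F`,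
equality holds `F`-almost everywhere, and it remains to exclude equality for large `|u|`.

If `m > 0`, the right side is unbounded while `D ≤ ∑ |log p_i|`. If `m = 0`, then `D ≤ C`
everywhere. Sending `u` to infinity inside a phase sector makes one outermost cell certain, whence
`-log p_i ≤ C` for these cells. For every large `u` the other cells are so rare that `w_i < p_i exp
C`. Thus each term `w_i log (w_i / p_i)` is strictly below `w_i C`, and `D(u) < C`
(`relEntropy_lt`). -/

noncomputable section

namespace PolarQuantization

open Filter Topology

/-! ### Information and relative entropy for finite-output channels -/

section Channel

variable {ι X : Type*} [Fintype ι] [MeasurableSpace X]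

/-- A channel with finite output alphabet all of whose transition probabilities are positive. -/
structure IsPositiveChannel (w : ι → X → ℝ) : Prop where
  measurable : ∀ i, Measurable (w i)
  pos : ∀ i u, 0 < w i u
  sum_eq_one : ∀ u, ∑ i, w i u = 1

/-- Minus the entropy (in nats) of the output given the input `u`. -/
def negEntropy (w : ι → X → ℝ) (u : X) : ℝ := ∑ i, w i u * Real.log (w i u)

/-- The probability of the output `i` under the input law `F`. -/
def outputProb (w : ι → X → ℝ) (F : Measure X) (i : ι) : ℝ := ∫ u, w i u ∂F

/-- The mutual information in nats. -/
def natInfo (w : ι → X → ℝ) (F : Measure X) : ℝ :=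
  ∫ u, negEntropy w u ∂F - ∑ i, outputProb w F i * Real.log (outputProb w F i)

/-- The relative entropy of the output law given `u` with respect to `r`. -/
def relEntropy (w : ι → X → ℝ) (r : ι → ℝ) (u : X) : ℝ :=
  negEntropy w u - ∑ i, w i u * Real.log (r i)

/-- The mixture `(1 - t) F + t G`. -/
def mixture (F G : Measure X) (t : ℝ) : Measure X :=
  ENNReal.ofReal (1 - t) • F + ENNReal.ofReal t • G

theorem isProbabilityMeasure_mixture {F G : Measure X} [IsProbabilityMeasure F]
    [IsProbabilityMeasure G] {t : ℝ} (h0 : 0 ≤ t) (h1 : t ≤ 1) :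
    IsProbabilityMeasure (mixture F G t) := by
  constructor
  simp only [mixture, Measure.add_apply, Measure.smul_apply, measure_univ, smul_eq_mul, mul_one]
  rw [← ENNReal.ofReal_add (by linarith) h0]
  simp

theorem integral_mixture {F G : Measure X} {t : ℝ} (h0 : 0 ≤ t) (h1 : t ≤ 1) {f : X → ℝ}
    (hF : Integrable f F) (hG : Integrable f G) :
    ∫ u, f u ∂(mixture F G t) = (1 - t) * ∫ u, f u ∂F + t * ∫ u, f u ∂G := by
  rw [mixture, integral_add_measure (hF.smul_measure (by simp)) (hG.smul_measure (by simp)),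
    integral_smul_measure, integral_smul_measure,
    ENNReal.toReal_ofReal (by linarith), ENNReal.toReal_ofReal h0]
  simp

theorem lintegral_mixture_le {F G : Measure X} {t : ℝ} (h0 : 0 ≤ t) (h1 : t ≤ 1) {f : X → ℝ≥0∞}
    {c : ℝ≥0∞} (hF : ∫⁻ u, f u ∂F ≤ c) (hG : ∫⁻ u, f u ∂G ≤ c) :
    ∫⁻ u, f u ∂(mixture F G t) ≤ c := by
  rw [mixture, lintegral_add_measure, lintegral_smul_measure, lintegral_smul_measure]
  calc _ ≤ ENNReal.ofReal (1 - t) * c + ENNReal.ofReal t * c := by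
        simp only [smul_eq_mul]; gcongr
    _ = c := by
        rw [← add_mul, ← ENNReal.ofReal_add (by linarith) h0]
        simp

/-- Gibbs' inequality. -/
theorem sum_mul_log_le_sum_mul_log {p r : ι → ℝ} (hp : ∀ i, 0 < p i) (hr : ∀ i, 0 < r i)
    (hsum : ∑ i, p i = ∑ i, r i) :
    ∑ i, p i * Real.log (r i) ≤ ∑ i, p i * Real.log (p i) := by
  have h : ∀ i, p i * Real.log (r i) ≤ p i * Real.log (p i) + (r i - p i) := by
    intro i
    have h1 := Real.log_le_sub_one_of_pos (div_pos (hr i) (hp i))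
    rw [Real.log_div (hr i).ne' (hp i).ne'] at h1
    have h2 := mul_le_mul_of_nonneg_left h1 (hp i).le
    have h3 : p i * (r i / p i - 1) = r i - p i := by
      field_simp [(hp i).ne']
    linarith
  calc _ ≤ ∑ i, (p i * Real.log (p i) + (r i - p i)) := Finset.sum_le_sum fun i _ => h i
    _ = _ := by rw [Finset.sum_add_distrib, Finset.sum_sub_distrib, hsum]; ring

namespace IsPositiveChannel

variable {w : ι → X → ℝ}

theorem le_one (hw : IsPositiveChannel w) (i : ι) (u : X) : w i u ≤ 1 := by
  rw [← hw.sum_eq_one u]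
  exact Finset.single_le_sum (f := fun j => w j u) (fun j _ => (hw.pos j u).le) (Finset.mem_univ i)

theorem integrable (hw : IsPositiveChannel w) (F : Measure X) [IsProbabilityMeasure F] (i : ι) :
    Integrable (w i) F :=
  Integrable.of_bound (hw.measurable i).aestronglyMeasurable 1 (ae_of_all _ fun u => by
    rw [Real.norm_eq_abs, abs_of_pos (hw.pos i u)]
    exact hw.le_one i u)

theorem integrable_negEntropy (hw : IsPositiveChannel w) (F : Measure X) [IsProbabilityMeasure F] :
    Integrable (negEntropy w) F := by
  refine integrable_finsetSum _ fun i _ => Integrable.of_bound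
    ((hw.measurable i).mul (hw.measurable i).log).aestronglyMeasurable 1 (ae_of_all _ fun u => ?_)
  rw [Real.norm_eq_abs, mul_comm]
  exact (Real.abs_log_mul_self_lt _ (hw.pos i u) (hw.le_one i u)).le

theorem negEntropy_nonpos (hw : IsPositiveChannel w) (u : X) : negEntropy w u ≤ 0 :=
  Finset.sum_nonpos fun i _ => mul_nonpos_of_nonneg_of_nonpos (hw.pos i u).le
    (Real.log_nonpos (hw.pos i u).le (hw.le_one i u))

theorem outputProb_pos (hw : IsPositiveChannel w) (F : Measure X) [IsProbabilityMeasure F] (i : ι) :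
    0 < outputProb w F i := by
  rw [outputProb, integral_pos_iff_support_of_nonneg (fun u => (hw.pos i u).le) (hw.integrable F i)]
  have : Function.support (w i) = Set.univ := by
    ext u; simp [(hw.pos i u).ne']
  simp [this]

theorem sum_outputProb (hw : IsPositiveChannel w) (F : Measure X) [IsProbabilityMeasure F] :
    ∑ i, outputProb w F i = 1 := by
  simp only [outputProb]
  rw [← integral_finsetSum _ fun i _ => hw.integrable F i]
  simp [hw.sum_eq_one]

theorem integrable_relEntropy (hw : IsPositiveChannel w) (F : Measure X)
    [IsProbabilityMeasure F] (r : ι → ℝ) :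
    Integrable (relEntropy w r) F :=
  (hw.integrable_negEntropy F).sub
    (integrable_finsetSum _ fun i _ => (hw.integrable F i).mul_const _)

theorem integral_relEntropy (hw : IsPositiveChannel w) (F : Measure X)
    [IsProbabilityMeasure F] (r : ι → ℝ) :
    ∫ u, relEntropy w r u ∂F =
      ∫ u, negEntropy w u ∂F - ∑ i, outputProb w F i * Real.log (r i) := by
  simp only [relEntropy]
  rw [integral_sub (hw.integrable_negEntropy F)
    (integrable_finsetSum _ fun i _ => (hw.integrable F i).mul_const _),
    integral_finsetSum _ fun i _ => (hw.integrable F i).mul_const _]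
  simp only [integral_mul_const, outputProb]

theorem relEntropy_le (hw : IsPositiveChannel w) (r : ι → ℝ) (u : X) :
    relEntropy w r u ≤ ∑ i, |Real.log (r i)| := by
  have h : ∀ i, -(w i u * Real.log (r i)) ≤ |Real.log (r i)| := fun i => by
    calc -(w i u * Real.log (r i)) ≤ |w i u * Real.log (r i)| := neg_le_abs _
      _ = w i u * |Real.log (r i)| := by rw [abs_mul, abs_of_pos (hw.pos i u)]
      _ ≤ 1 * |Real.log (r i)| := by gcongr; exact hw.le_one i u
      _ = _ := one_mul _
  have := Finset.sum_le_sum fun i (_ : i ∈ Finset.univ) => h i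
  rw [Finset.sum_neg_distrib] at this
  have h2 := hw.negEntropy_nonpos u
  rw [relEntropy]
  linarith

/-- If moving from `F` towards `G` never increases the mutual information, then the mean under `G`
of the relative entropy with respect to the output law of `F` is at most the mutual information
of `F`. -/
theorem integral_relEntropy_le_natInfo (hw : IsPositiveChannel w) (F G : Measure X)
    [IsProbabilityMeasure F] [IsProbabilityMeasure G]
    (h : ∀ t : ℝ, 0 < t → t < 1 → natInfo w (mixture F G t) ≤ natInfo w F) :
    ∫ u, relEntropy w (outputProb w F) u ∂G ≤ natInfo w F := by
  rw [hw.integral_relEntropy]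
  set a := outputProb w F with ha
  set b := outputProb w G with hb
  -- Gibbs' inequality bounds the cross term weighted by `a`, so the contribution of `F` cancels and
  -- `t` can be divided out. Letting `t → 0` then replaces differentiation of the information.
  have key : ∀ t : ℝ, 0 < t → t < 1 →
      ∫ u, negEntropy w u ∂G - ∑ i, b i * Real.log ((1 - t) * a i + t * b i) ≤ natInfo w F := by
    intro t h0 h1
    have hp : ∀ i, outputProb w (mixture F G t) i = (1 - t) * a i + t * b i := fun i =>
      integral_mixture h0.le h1.le (hw.integrable F i) (hw.integrable G i)
    have hm := h t h0 h1
    have hpm : IsProbabilityMeasure (mixture F G t) := isProbabilityMeasure_mixture h0.le h1.le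
    have hsum : ∑ i, a i = ∑ i, ((1 - t) * a i + t * b i) := by
      simp_rw [← hp]
      rw [hw.sum_outputProb, hw.sum_outputProb]
    have hg := sum_mul_log_le_sum_mul_log (fun i => hw.outputProb_pos F i)
      (fun i => by rw [← hp]; exact hw.outputProb_pos _ i) hsum
    rw [natInfo, integral_mixture h0.le h1.le (hw.integrable_negEntropy F)
      (hw.integrable_negEntropy G)] at hm
    simp only [hp] at hm
    have hsplit : ∑ i, ((1 - t) * a i + t * b i) * Real.log ((1 - t) * a i + t * b i) =
        (1 - t) * ∑ i, a i * Real.log ((1 - t) * a i + t * b i) +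
        t * ∑ i, b i * Real.log ((1 - t) * a i + t * b i) := by
      rw [Finset.mul_sum, Finset.mul_sum, ← Finset.sum_add_distrib]
      exact Finset.sum_congr rfl fun i _ => by ring
    rw [hsplit] at hm
    have hg2 := mul_le_mul_of_nonneg_left hg (by linarith : (0 : ℝ) ≤ 1 - t)
    have hF : natInfo w F = ∫ u, negEntropy w u ∂F - ∑ i, a i * Real.log (a i) := rfl
    rw [hF] at hm ⊢
    refine le_of_mul_le_mul_left ?_ h0
    linarith
  have hlim : Tendsto (fun t : ℝ => ∫ u, negEntropy w u ∂G -
      ∑ i, b i * Real.log ((1 - t) * a i + t * b i)) (𝓝[>] 0)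
      (𝓝 (∫ u, negEntropy w u ∂G - ∑ i, b i * Real.log (a i))) := by
    refine tendsto_const_nhds.sub (tendsto_finsetSum _ fun i _ => tendsto_const_nhds.mul ?_)
    have hc : ContinuousAt (fun t : ℝ => Real.log ((1 - t) * a i + t * b i)) 0 := by
      refine ContinuousAt.log (by fun_prop) ?_
      simpa using (hw.outputProb_pos F i).ne'
    have := hc.tendsto.mono_left (nhdsWithin_le_nhds (s := Set.Ioi 0))
    simpa using this
  refine le_of_tendsto hlim ?_
  filter_upwards [Ioo_mem_nhdsGT (zero_lt_one (α := ℝ))] with t ht using key t ht.1 ht.2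

/-- The relative entropy is strictly below `c` once the outputs outside `L` are unlikely, provided
that the outputs in `L` have probability at least `exp (-c)` under `r`. -/
theorem relEntropy_lt [Nontrivial ι] (hw : IsPositiveChannel w) {r : ι → ℝ} (hr : ∀ i, 0 < r i)
    {c : ℝ} {L : Set ι}
    (hL : ∀ i ∈ L, -Real.log (r i) ≤ c) {u : X} (hu : ∀ i ∉ L, w i u < r i * Real.exp c) :
    relEntropy w r u < c := by
  -- With two outputs of positive probability none is certain; this supplies the strictness on `L`,
  -- where `hL` is not strict.
  have hlt : ∀ i, w i u < 1 := by
    intro i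
    obtain ⟨j, hj⟩ := exists_ne i
    rw [← hw.sum_eq_one u]
    exact Finset.single_lt_sum hj (Finset.mem_univ i) (Finset.mem_univ j) (hw.pos j u)
      fun k _ _ => (hw.pos k u).le
  have h : ∀ i, w i u * Real.log (w i u) - w i u * Real.log (r i) < w i u * c := by
    intro i
    rw [← mul_sub]
    refine mul_lt_mul_of_pos_left ?_ (hw.pos i u)
    by_cases hi : i ∈ L
    · have := Real.log_neg (hw.pos i u) (hlt i)
      linarith [hL i hi]
    · have := Real.log_lt_log (hw.pos i u) (hu i hi)
      rw [Real.log_mul (hr i).ne' (Real.exp_pos c).ne', Real.log_exp] at this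
      linarith
  calc relEntropy w r u = ∑ i, (w i u * Real.log (w i u) - w i u * Real.log (r i)) := by
        rw [relEntropy, negEntropy, Finset.sum_sub_distrib]
    _ < ∑ i, w i u * c := Finset.sum_lt_sum_of_nonempty Finset.univ_nonempty fun i _ => h i
    _ = c := by rw [← Finset.sum_mul, hw.sum_eq_one, one_mul]

/-- Along inputs for which the output `i` becomes certain, the relative entropy tends to
`-log (r i)`. -/
theorem tendsto_relEntropy (hw : IsPositiveChannel w) (r : ι → ℝ) {i : ι} {v : ℕ → X}
    (hv : Tendsto (fun n => w i (v n)) atTop (𝓝 1)) :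
    Tendsto (fun n => relEntropy w r (v n)) atTop (𝓝 (-Real.log (r i))) := by
  classical
  have h : ∀ j, Tendsto (fun n => w j (v n)) atTop (𝓝 (if j = i then 1 else 0)) := by
    intro j
    split_ifs with hj
    · exact hj ▸ hv
    · have h1 : Tendsto (fun n => 1 - w i (v n)) atTop (𝓝 0) := by
        simpa using hv.const_sub 1
      refine squeeze_zero (fun n => (hw.pos j _).le) (fun n => ?_) h1
      rw [← hw.sum_eq_one (v n), le_sub_iff_add_le, ← Finset.sum_pair (f := fun k => w k (v n)) hj]
      exact Finset.sum_le_sum_of_subset_of_nonneg (Finset.subset_univ _)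
        fun k _ _ => (hw.pos k _).le
  have h2 : Tendsto (fun n => relEntropy w r (v n)) atTop
      (𝓝 (∑ j, (if j = i then (1 : ℝ) else 0) * Real.log (if j = i then (1 : ℝ) else 0) -
        ∑ j, (if j = i then (1 : ℝ) else 0) * Real.log (r j))) := by
    refine Tendsto.sub (tendsto_finsetSum _ fun j _ => ?_)
      (tendsto_finsetSum _ fun j _ => (h j).mul_const _)
    exact (Real.continuous_mul_log.tendsto _).comp (h j)
  have h3 : ∀ j, (if j = i then (1 : ℝ) else 0) * Real.log (if j = i then (1 : ℝ) else 0) = 0 := by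
    intro j; split_ifs <;> simp
  simpa [h3] using h2

end IsPositiveChannel

end Channel

/-! ### Multiplier and the abstract support bound -/

/-- A Lagrange multiplier for the maximization of the mean of `E` over two-point laws under the
constraint that the mean of `s` is at most `P`. -/
theorem exists_multiplier {X : Type*} {E s : X → ℝ} {P c : ℝ} {x₀ : X} (hx₀ : s x₀ < P)
    (h : ∀ a b t, 0 ≤ t → t ≤ 1 → (1 - t) * s a + t * s b ≤ P → (1 - t) * E a + t * E b ≤ c) :
    ∃ m : ℝ, 0 ≤ m ∧ ∀ x, E x ≤ c + m * (s x - P) := by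
  have hle : ∀ a, s a ≤ P → E a ≤ c := fun a ha => by
    simpa using h a a 0 le_rfl zero_le_one (by simpa using ha)
  -- The weight on `b` is the one that meets the constraint with equality.
  have hcross : ∀ a b, s a < P → P < s b → (P - s a) * (E b - c) ≤ (s b - P) * (c - E a) := by
    intro a b ha hb
    have hd : 0 < s b - s a := by linarith
    have h1 := h a b ((P - s a) / (s b - s a)) (div_nonneg (by linarith) hd.le)
      ((div_le_one hd).2 (by linarith)) (by
        apply le_of_eq; field_simp; ring)
    have h2 := mul_le_mul_of_nonneg_left h1 hd.le
    have h3 : (s b - s a) * ((1 - (P - s a) / (s b - s a)) * E a +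
        (P - s a) / (s b - s a) * E b) = (s b - P) * E a + (P - s a) * E b := by
      field_simp; ring
    rw [h3] at h2
    linarith
  -- The multiplier is the largest slope demanded by points above the budget; inserting 0 makes it
  -- nonnegative. By `hcross`, each point strictly below the budget bounds these slopes, and `x₀` is
  -- one such point.
  set K : Set ℝ := insert 0 ((fun b => (E b - c) / (s b - P)) '' {b | P < s b}) with hK
  have hub : ∀ a, s a < P → (c - E a) / (P - s a) ∈ upperBounds K := by
    rintro a ha _ (rfl | ⟨b, hb, rfl⟩)
    · exact div_nonneg (by linarith [hle a ha.le]) (by linarith)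
    · have hb' : P < s b := hb
      rw [div_le_div_iff₀ (by linarith) (by linarith)]
      linarith [hcross a b ha hb']
  have hbdd : BddAbove K := ⟨_, hub x₀ hx₀⟩
  refine ⟨sSup K, le_csSup hbdd (Set.mem_insert _ _), fun x => ?_⟩
  rcases lt_trichotomy (s x) P with hx | hx | hx
  · have h1 : sSup K ≤ (c - E x) / (P - s x) := csSup_le ⟨0, Set.mem_insert _ _⟩ (hub x hx)
    rw [le_div_iff₀ (by linarith)] at h1
    linarith
  · have := hle x hx.le
    rw [hx]; linarith
  · have h1 : (E x - c) / (s x - P) ≤ sSup K :=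
      le_csSup hbdd (Set.mem_insert_of_mem _ ⟨x, hx, rfl⟩)
    rw [div_le_iff₀ (by linarith)] at h1
    linarith

theorem isBounded_support_of_ae_norm_le {F : Measure ℂ} {R : ℝ} (h : ∀ᵐ u ∂F, ‖u‖ ≤ R) :
    Bornology.IsBounded F.support := by
  refine (Metric.isBounded_closedBall (x := (0 : ℂ)) (r := R)).subset ?_
  refine Measure.support_subset_of_isClosed Metric.isClosed_closedBall ?_
  filter_upwards [h] with u hu
  simpa using hu

/-- An input law that maximizes the mutual information under a second-moment constraint has bounded
support, if far away inputs only produce outputs in `L`, each of which can be made certain. -/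
theorem isBounded_support_of_maximal {ι : Type*} [Fintype ι] [Nontrivial ι] {w : ι → ℂ → ℝ}
    (hw : IsPositiveChannel w) (L : Set ι)
    (hout : ∀ i ∉ L, Tendsto (w i) (Bornology.cobounded ℂ) (𝓝 0))
    (hin : ∀ i ∈ L, ∃ v : ℕ → ℂ, Tendsto (fun n => w i (v n)) atTop (𝓝 1))
    {P : ℝ} (hP : 0 ≤ P) (F : Measure ℂ) [IsProbabilityMeasure F]
    (hF : ∫⁻ u, ‖u‖ₑ ^ 2 ∂F ≤ ENNReal.ofReal P)
    (hmax : ∀ G : Measure ℂ, IsProbabilityMeasure G → ∫⁻ u, ‖u‖ₑ ^ 2 ∂G ≤ ENNReal.ofReal P →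
      natInfo w G ≤ natInfo w F) :
    Bornology.IsBounded F.support := by
  -- With zero budget no input is strictly feasible, but `F` is then concentrated at 0.
  rcases hP.eq_or_lt with rfl | hP
  · rw [ENNReal.ofReal_zero, nonpos_iff_eq_zero, lintegral_eq_zero_iff (by fun_prop)] at hF
    refine isBounded_support_of_ae_norm_le (R := 0) ?_
    filter_upwards [hF] with u hu
    simpa using hu
  set E := relEntropy w (outputProb w F)
  have hsq : ∀ u : ℂ, ‖u‖ₑ ^ 2 = ENNReal.ofReal (‖u‖ ^ 2) := fun u => by
    rw [ENNReal.ofReal_pow (norm_nonneg u), ofReal_norm]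
  obtain ⟨m, hm0, hm⟩ := exists_multiplier (E := E) (s := fun u : ℂ => ‖u‖ ^ 2) (P := P)
    (c := natInfo w F) (x₀ := 0) (by simpa using hP) (by
      intro a b t h0 h1 hab
      have hGp : IsProbabilityMeasure (mixture (Measure.dirac a) (Measure.dirac b) t) :=
        isProbabilityMeasure_mixture h0 h1
      have hG : ∫⁻ u, ‖u‖ₑ ^ 2 ∂(mixture (Measure.dirac a) (Measure.dirac b) t) ≤
          ENNReal.ofReal P := by
        rw [mixture, lintegral_add_measure, lintegral_smul_measure, lintegral_smul_measure,
          lintegral_dirac, lintegral_dirac, hsq, hsq, smul_eq_mul, smul_eq_mul,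
          ← ENNReal.ofReal_mul (by linarith), ← ENNReal.ofReal_mul h0,
          ← ENNReal.ofReal_add (mul_nonneg (by linarith) (by positivity)) (by positivity)]
        exact ENNReal.ofReal_le_ofReal hab
      have := hw.integral_relEntropy_le_natInfo F _ fun s hs0 hs1 =>
        hmax _ (isProbabilityMeasure_mixture hs0.le hs1.le)
          (lintegral_mixture_le hs0.le hs1.le hF hG)
      rwa [integral_mixture h0 h1 (hw.integrable_relEntropy _ _) (hw.integrable_relEntropy _ _),
        integral_dirac, integral_dirac] at this)
  have hint : Integrable (fun u : ℂ => ‖u‖ ^ 2) F := by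
    refine ⟨by fun_prop, ?_⟩
    rw [hasFiniteIntegral_iff_ofReal (ae_of_all _ fun u => by positivity)]
    simp_rw [← hsq]
    exact hF.trans_lt ENNReal.ofReal_lt_top
  have hmom : ∫ u, ‖u‖ ^ 2 ∂F ≤ P := by
    rw [integral_eq_lintegral_of_nonneg_ae (ae_of_all _ fun u => by positivity) (by fun_prop)]
    simp_rw [← hsq]
    exact ENNReal.toReal_le_of_le_ofReal hP.le hF
  have hEint : Integrable E F := hw.integrable_relEntropy F _
  have hEI : ∫ u, E u ∂F = natInfo w F := hw.integral_relEntropy F _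
  have hsub : Integrable (fun u : ℂ => m * (‖u‖ ^ 2 - P)) F :=
    (hint.sub (integrable_const P)).const_mul m
  have hDint : Integrable (fun u => natInfo w F + m * (‖u‖ ^ 2 - P)) F :=
    (integrable_const _).add hsub
  -- The slack in the multiplier inequality is nonnegative, and its mean `m (E|u|² - P)` is
  -- nonpositive.
  have hae : ∀ᵐ u ∂F, natInfo w F + m * (‖u‖ ^ 2 - P) - E u = 0 := by
    have h0 : 0 ≤ fun u => natInfo w F + m * (‖u‖ ^ 2 - P) - E u := fun u => by
      have := hm u
      simp only [Pi.zero_apply]; linarith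
    refine (integral_eq_zero_iff_of_nonneg h0 (hDint.sub hEint)).1 (le_antisymm ?_
      (integral_nonneg h0))
    rw [integral_sub hDint hEint, hEI, integral_add (integrable_const _) hsub,
      integral_const_mul, integral_sub hint (integrable_const _)]
    have := mul_nonneg hm0 (sub_nonneg.2 hmom)
    simp only [integral_const, probReal_univ, smul_eq_mul, one_mul]
    linarith
  rcases hm0.eq_or_lt with rfl | hmpos
  · have hle : ∀ u, E u ≤ natInfo w F := fun u => by simpa using hm u
    have hL : ∀ i ∈ L, -Real.log (outputProb w F i) ≤ natInfo w F := fun i hi => by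
      obtain ⟨v, hv⟩ := hin i hi
      exact le_of_tendsto' (hw.tendsto_relEntropy _ hv) fun n => hle _
    have hfar : ∀ᶠ u in Bornology.cobounded ℂ, ∀ i, i ∉ L →
        w i u < outputProb w F i * Real.exp (natInfo w F) := by
      refine eventually_all.2 fun i => ?_
      by_cases hi : i ∈ L
      · simp [hi]
      · filter_upwards [(hout i hi).eventually_lt_const
          (mul_pos (hw.outputProb_pos F i) (Real.exp_pos _))] with u hu _ using hu
    rw [← comap_norm_atTop, eventually_comap] at hfar
    obtain ⟨R, hR⟩ := eventually_atTop.1 hfar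
    refine isBounded_support_of_ae_norm_le (R := R) ?_
    filter_upwards [hae] with u hu
    by_contra hlt
    have := hw.relEntropy_lt (fun i => hw.outputProb_pos F i) hL
      (hR ‖u‖ (not_le.1 hlt).le u rfl)
    simp only [zero_mul, add_zero] at hu
    linarith
  · set B := ∑ i, |Real.log (outputProb w F i)|
    refine isBounded_support_of_ae_norm_le (R := Real.sqrt ((B - natInfo w F) / m + P)) ?_
    filter_upwards [hae] with u hu
    refine Real.le_sqrt_of_sq_le ?_
    have hB := hw.relEntropy_le (outputProb w F) u
    rw [← sub_le_iff_le_add, le_div_iff₀ hmpos]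
    linarith

/-! ### The Gaussian law of the received signal -/

theorem isProbabilityMeasure_receivedLaw {σ : ℝ} (hσ : 0 < σ) (u : ℂ) :
    IsProbabilityMeasure (receivedLaw σ u) := by
  constructor
  rw [receivedLaw, withDensity_apply _ MeasurableSet.univ, Measure.restrict_univ,
    lintegral_sub_right_eq_self (fun z : ℂ => ENNReal.ofReal
      (1 / (Real.pi * σ ^ 2) * Real.exp (-(‖z‖ ^ 2 / σ ^ 2)))) u]
  have hb : 0 < (σ ^ 2)⁻¹ := by positivity
  have hval : ∫ z : ℂ, Real.exp (-(‖z‖ ^ 2 / σ ^ 2)) = Real.pi * σ ^ 2 := by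
    have h := GaussianFourier.integral_rexp_neg_mul_sq_norm (V := ℂ) hb
    have h2 : ∀ z : ℂ, -(‖z‖ ^ 2 / σ ^ 2) = -(σ ^ 2)⁻¹ * ‖z‖ ^ 2 := fun z => by
      rw [div_eq_mul_inv]; ring
    simp_rw [h2]
    rw [h, Complex.finrank_real_complex]
    norm_num
  have hne : Real.pi * σ ^ 2 ≠ 0 := by positivity
  rw [← ofReal_integral_eq_lintegral_ofReal, integral_const_mul, hval, one_div_mul_cancel hne,
    ENNReal.ofReal_one]
  -- A non-integrable function has integral 0 by convention, so the nonzero value `hval` proves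
  -- integrability.
  · refine Integrable.const_mul (not_imp_comm.1 integral_undef ?_) _
    rw [hval]; exact hne
  · exact ae_of_all _ fun z => by positivity

theorem receivedLaw_apply (σ : ℝ) (u : ℂ) {A : Set ℂ} (hA : MeasurableSet A) :
    receivedLaw σ u A = ∫⁻ z in A, ENNReal.ofReal
      (1 / (Real.pi * σ ^ 2) * Real.exp (-(‖z - u‖ ^ 2 / σ ^ 2))) := by
  rw [receivedLaw, withDensity_apply _ hA]

/-- Translation invariance reduces balls around a moving input to one fixed law. -/
theorem receivedLaw_ball (σ : ℝ) (u : ℂ) (r : ℝ) :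
    receivedLaw σ u (Metric.ball u r) = receivedLaw σ 0 (Metric.ball 0 r) := by
  rw [receivedLaw_apply _ _ measurableSet_ball, receivedLaw_apply _ _ measurableSet_ball,
    ← lintegral_indicator measurableSet_ball, ← lintegral_indicator measurableSet_ball,
    ← lintegral_sub_right_eq_self ((Metric.ball (0 : ℂ) r).indicator _) u]
  refine lintegral_congr fun z => ?_
  classical
  simp [Set.indicator_apply, dist_eq_norm]

theorem tendsto_receivedLaw_ball {σ : ℝ} (hσ : 0 < σ) :
    Tendsto (fun r : ℝ => (receivedLaw σ 0).real (Metric.ball 0 r)) atTop (𝓝 1) := by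
  have := isProbabilityMeasure_receivedLaw hσ 0
  have h := tendsto_measure_iUnion_atTop (μ := receivedLaw σ 0)
    (s := fun r : ℝ => Metric.ball (0 : ℂ) r) fun r s hrs => Metric.ball_subset_ball hrs
  have hU : ⋃ r : ℝ, Metric.ball (0 : ℂ) r = Set.univ :=
    Set.eq_univ_of_forall fun z => Set.mem_iUnion.2 ⟨‖z‖ + 1, by simp⟩
  rw [hU, measure_univ] at h
  simpa [Measure.real, Function.comp_def] using (ENNReal.tendsto_toReal ENNReal.one_ne_top).comp h

theorem measurable_receivedLaw_apply (σ : ℝ) {A : Set ℂ} (hA : MeasurableSet A) :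
    Measurable fun u => (receivedLaw σ u).real A := by
  simp only [Measure.real, receivedLaw_apply _ _ hA]
  refine Measurable.ennreal_toReal (Measurable.lintegral_prod_right' (f := fun p : ℂ × ℂ =>
    ENNReal.ofReal (1 / (Real.pi * σ ^ 2) * Real.exp (-(‖p.2 - p.1‖ ^ 2 / σ ^ 2)))) ?_)
  fun_prop

theorem receivedLaw_pos {σ : ℝ} (hσ : 0 < σ) (u : ℂ) {U : Set ℂ} (hU : IsOpen U)
    (hne : U.Nonempty) : 0 < receivedLaw σ u U := by
  rw [receivedLaw_apply _ _ hU.measurableSet,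
    lintegral_pos_iff_support (by fun_prop)]
  have : Function.support (fun z : ℂ => ENNReal.ofReal
      (1 / (Real.pi * σ ^ 2) * Real.exp (-(‖z - u‖ ^ 2 / σ ^ 2)))) = Set.univ := by
    refine Set.eq_univ_of_forall fun z => ?_
    rw [Function.mem_support, ← pos_iff_ne_zero, ENNReal.ofReal_pos]
    positivity
  rw [this, Measure.restrict_apply_univ]
  exact hU.measure_pos _ hne

/-! ### Geometry of the quantization cells -/

/-- `Complex.arg` takes values in `(-π, π]`, so passing to `[-π, π)` moves only the value `π`. -/
theorem toIcoMod_arg (z : ℂ) : toIcoMod Real.two_pi_pos (-Real.pi) z.arg =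
    if z.arg = Real.pi then -Real.pi else z.arg := by
  split_ifs with h
  · rw [h, toIcoMod_eq_iff]
    refine ⟨⟨le_rfl, by linarith [Real.pi_pos]⟩, 1, ?_⟩
    simp; ring
  · rw [toIcoMod_eq_self]
    exact ⟨(Complex.neg_pi_lt_arg z).le, by
      linarith [lt_of_le_of_ne (Complex.arg_le_pi z) h]⟩

theorem measurableSet_phaseRegion (b₁ : ℕ) (y₁ : Fin (2 ^ b₁)) :
    MeasurableSet (phaseRegion b₁ y₁) := by
  simp only [phaseRegion, toIcoMod_arg]
  have : Measurable fun z : ℂ => if z.arg = Real.pi then -Real.pi else z.arg :=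
    Measurable.ite (Complex.measurable_arg (measurableSet_singleton _)) measurable_const
      Complex.measurable_arg
  exact this measurableSet_Ico

theorem measurableSet_magnitudeRegion (b₂ : ℕ) (q : Fin (2 ^ b₂ + 1) → ℝ≥0∞)
    (y₂ : Fin (2 ^ b₂)) : MeasurableSet (magnitudeRegion b₂ q y₂) :=
  (measurableSet_le measurable_const measurable_enorm).inter
    (measurableSet_lt measurable_enorm measurable_const)

theorem exists_mem_phaseRegion (b₁ : ℕ) (z : ℂ) : ∃ y₁, z ∈ phaseRegion b₁ y₁ := by
  have hx := toIcoMod_mem_Ico Real.two_pi_pos (-Real.pi) z.arg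
  simp only [phaseRegion, Set.mem_ofPred_eq]
  set x := toIcoMod Real.two_pi_pos (-Real.pi) z.arg
  have hpi := Real.pi_pos
  have hN : (0 : ℝ) < 2 ^ b₁ := by positivity
  set d := 2 * Real.pi / 2 ^ b₁ with hd
  have hd0 : 0 < d := by positivity
  have hdN : d * 2 ^ b₁ = 2 * Real.pi := by rw [hd]; field_simp
  have h0 : 0 ≤ (x + Real.pi) / d := div_nonneg (by linarith [hx.1]) hd0.le
  have hlt : (x + Real.pi) / d < 2 ^ b₁ := by
    rw [div_lt_iff₀ hd0]; linarith [hx.2, mul_comm d (2 ^ b₁)]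
  refine ⟨⟨⌊(x + Real.pi) / d⌋₊, ?_⟩, ?_, ?_⟩
  · rw [Nat.floor_lt h0]; exact_mod_cast hlt
  · have := Nat.floor_le h0
    rw [le_div_iff₀ hd0] at this
    simp only; linarith
  · have := Nat.lt_floor_add_one ((x + Real.pi) / d)
    rw [div_lt_iff₀ hd0] at this
    simp only; linarith

theorem eq_of_mem_phaseRegion {b₁ : ℕ} {z : ℂ} {y y' : Fin (2 ^ b₁)} (h : z ∈ phaseRegion b₁ y)
    (h' : z ∈ phaseRegion b₁ y') : y = y' := by
  have hd0 : 0 < 2 * Real.pi / 2 ^ b₁ := by positivity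
  have key : ∀ {a b : ℕ} {x : ℝ}, 2 * Real.pi / 2 ^ b₁ * (a : ℝ) - Real.pi ≤ x →
      x < 2 * Real.pi / 2 ^ b₁ * ((b : ℝ) + 1) - Real.pi → a ≤ b := by
    intro a b x h1 h2
    have h3 : (a : ℝ) < b + 1 := lt_of_mul_lt_mul_left (by linarith) hd0.le
    exact Nat.lt_succ_iff.1 (by exact_mod_cast h3)
  exact Fin.ext (le_antisymm (key h.1 h'.2) (key h'.1 h.2))

theorem exists_mem_magnitudeRegion {b₂ : ℕ} {q : Fin (2 ^ b₂ + 1) → ℝ≥0∞}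
    (hq : IsThresholds b₂ q) (z : ℂ) : ∃ y₂, z ∈ magnitudeRegion b₂ q y₂ := by
  classical
  -- The cell starts at the largest threshold not exceeding `|z|`, which is not the last one because
  -- that is infinite.
  set S : Finset (Fin (2 ^ b₂ + 1)) := {i | q i ≤ ‖z‖ₑ} with hS
  have hne : S.Nonempty := ⟨0, by simp [hS, hq.zero]⟩
  have hmem : q (S.max' hne) ≤ ‖z‖ₑ := by simpa [hS] using S.max'_mem hne
  have hlast : S.max' hne ≠ Fin.last _ := fun h => by
    rw [h, hq.last] at hmem
    exact absurd (top_le_iff.1 hmem) enorm_ne_top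
  obtain ⟨y, hy⟩ := Fin.exists_castSucc_eq.2 hlast
  refine ⟨y, by rwa [hy], ?_⟩
  by_contra hlt
  have h1 : y.succ ≤ S.max' hne := S.le_max' _ (by simpa [hS] using hlt)
  rw [← hy] at h1
  exact absurd (Fin.castSucc_lt_succ (i := y)) (not_lt.2 h1)

theorem eq_of_mem_magnitudeRegion {b₂ : ℕ} {q : Fin (2 ^ b₂ + 1) → ℝ≥0∞} (hq : IsThresholds b₂ q)
    {z : ℂ} {y y' : Fin (2 ^ b₂)} (h : z ∈ magnitudeRegion b₂ q y)
    (h' : z ∈ magnitudeRegion b₂ q y') : y = y' := by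
  have key : ∀ {a b : Fin (2 ^ b₂)}, z ∈ magnitudeRegion b₂ q a → z ∈ magnitudeRegion b₂ q b →
      a ≤ b := by
    intro a b ha hb
    have := hq.strictMono.lt_iff_lt.1 (ha.1.trans_lt hb.2)
    exact Fin.castSucc_lt_succ_iff.1 this
  exact le_antisymm (key h h') (key h' h)

/-- The open part of a phase region. -/
def openSector (b₁ : ℕ) (y₁ : Fin (2 ^ b₁)) : Set ℂ :=
  Complex.slitPlane ∩ Complex.arg ⁻¹' Set.Ioo (2 * Real.pi / 2 ^ b₁ * (y₁ : ℕ) - Real.pi)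
    (2 * Real.pi / 2 ^ b₁ * ((y₁ : ℕ) + 1) - Real.pi)

theorem isOpen_openSector (b₁ : ℕ) (y₁ : Fin (2 ^ b₁)) : IsOpen (openSector b₁ y₁) :=
  ContinuousOn.isOpen_inter_preimage
    (fun _ hz => (Complex.continuousAt_arg hz).continuousWithinAt) Complex.isOpen_slitPlane
    isOpen_Ioo

theorem openSector_subset_phaseRegion (b₁ : ℕ) (y₁ : Fin (2 ^ b₁)) :
    openSector b₁ y₁ ⊆ phaseRegion b₁ y₁ := by
  rintro z ⟨hz, h1, h2⟩
  rw [phaseRegion, Set.mem_ofPred_eq, toIcoMod_arg,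
    if_neg (Complex.mem_slitPlane_iff_arg.1 hz).1]
  exact ⟨h1.le, h2⟩

/-- Sectors are cones, so a ball in a sector can be dilated without leaving it. -/
theorem smul_mem_openSector {b₁ : ℕ} {y₁ : Fin (2 ^ b₁)} {z : ℂ} (hz : z ∈ openSector b₁ y₁)
    {r : ℝ} (hr : 0 < r) : (r : ℂ) * z ∈ openSector b₁ y₁ := by
  obtain ⟨hs, ha⟩ := hz
  rw [Complex.mem_slitPlane_iff_arg] at hs
  refine ⟨?_, ?_⟩
  · rw [Complex.mem_slitPlane_iff_arg, Complex.arg_real_mul z hr]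
    exact ⟨hs.1, mul_ne_zero (by exact_mod_cast hr.ne') hs.2⟩
  · rw [Set.mem_preimage, Complex.arg_real_mul z hr]
    exact ha

theorem exists_mem_openSector (b₁ : ℕ) (y₁ : Fin (2 ^ b₁)) :
    ∃ z ∈ openSector b₁ y₁, ‖z‖ = 1 := by
  have hpi := Real.pi_pos
  set d := 2 * Real.pi / 2 ^ b₁ with hd
  have hd0 : 0 < d := by positivity
  have hdN : d * 2 ^ b₁ = 2 * Real.pi := by rw [hd]; field_simp
  have hy : ((y₁ : ℕ) : ℝ) + 1 ≤ 2 ^ b₁ := by exact_mod_cast y₁.2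
  have hy' := mul_le_mul_of_nonneg_left hy hd0.le
  have hy0 : 0 ≤ d * ((y₁ : ℕ) : ℝ) := by positivity
  -- The bisecting direction of the sector.
  set θ := d * ((y₁ : ℕ) + 1 / 2) - Real.pi with hθ
  have hθ1 : -Real.pi < θ := by rw [hθ]; linarith
  have hθ2 : θ < Real.pi := by rw [hθ]; linarith
  have harg : (Complex.exp (θ * Complex.I)).arg = θ := by
    rw [Complex.arg_exp_mul_I, toIocMod_eq_self]
    exact ⟨hθ1, by linarith⟩
  refine ⟨Complex.exp (θ * Complex.I), ⟨?_, ?_⟩, Complex.norm_exp_ofReal_mul_I θ⟩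
  · rw [Complex.mem_slitPlane_iff_arg, harg]
    exact ⟨hθ2.ne, Complex.exp_ne_zero _⟩
  · rw [Set.mem_preimage, harg]
    exact ⟨by linarith, by linarith⟩

/-! ### Transition probabilities of the quantized channel -/

variable {σ : ℝ} {b₁ b₂ : ℕ} {q : Fin (2 ^ b₂ + 1) → ℝ≥0∞}

/-- Every cell contains a nonempty open set, and the Gaussian density is positive. -/
theorem W_pos (hσ : 0 < σ) (hq : IsThresholds b₂ q) (y₁ : Fin (2 ^ b₁)) (y₂ : Fin (2 ^ b₂))
    (u : ℂ) : 0 < W σ b₁ b₂ q y₁ y₂ u := by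
  have := isProbabilityMeasure_receivedLaw hσ u
  have hsub : openSector b₁ y₁ ∩ {z | q y₂.castSucc < ‖z‖ₑ ∧ ‖z‖ₑ < q y₂.succ} ⊆
      phaseRegion b₁ y₁ ∩ magnitudeRegion b₂ q y₂ :=
    Set.inter_subset_inter (openSector_subset_phaseRegion _ _) fun z hz => ⟨hz.1.le, hz.2⟩
  refine ENNReal.toReal_pos (lt_of_lt_of_le (receivedLaw_pos hσ u ?_ ?_)
    (measure_mono hsub)).ne' (measure_ne_top _ _)
  · exact (isOpen_openSector _ _).inter ((isOpen_lt continuous_const continuous_enorm).inter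
      (isOpen_lt continuous_enorm continuous_const))
  · obtain ⟨z, hz, hz1⟩ := exists_mem_openSector b₁ y₁
    obtain ⟨r, hr1, hr2⟩ := ENNReal.lt_iff_exists_nnreal_btwn.1
      (hq.strictMono (Fin.castSucc_lt_succ (i := y₂)))
    have hr0 : 0 < (r : ℝ) := by
      have : (0 : ℝ≥0∞) < r := lt_of_le_of_lt zero_le hr1
      exact_mod_cast this
    have hn : ‖((r : ℝ) : ℂ) * z‖ₑ = r := by
      rw [enorm_mul, ← ofReal_norm z, hz1, ← ofReal_norm, Complex.norm_real, Real.norm_eq_abs,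
        abs_of_pos hr0]
      simp
    exact ⟨((r : ℝ) : ℂ) * z, smul_mem_openSector hz hr0, by rw [hn]; exact hr1,
      by rw [hn]; exact hr2⟩

theorem sum_W (hσ : 0 < σ) (hq : IsThresholds b₂ q) (u : ℂ) :
    ∑ y : Fin (2 ^ b₁) × Fin (2 ^ b₂), W σ b₁ b₂ q y.1 y.2 u = 1 := by
  have := isProbabilityMeasure_receivedLaw hσ u
  simp only [W]
  rw [← measureReal_iUnion_fintype]
  · have : ⋃ y : Fin (2 ^ b₁) × Fin (2 ^ b₂), phaseRegion b₁ y.1 ∩ magnitudeRegion b₂ q y.2 =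
        Set.univ := Set.eq_univ_of_forall fun z => by
      obtain ⟨y₁, h₁⟩ := exists_mem_phaseRegion b₁ z
      obtain ⟨y₂, h₂⟩ := exists_mem_magnitudeRegion hq z
      exact Set.mem_iUnion.2 ⟨(y₁, y₂), h₁, h₂⟩
    rw [this, probReal_univ]
  · intro y y' hne
    refine Set.disjoint_left.2 fun z hz hz' => hne (Prod.ext ?_ ?_)
    · exact eq_of_mem_phaseRegion hz.1 hz'.1
    · exact eq_of_mem_magnitudeRegion hq hz.2 hz'.2
  · exact fun y => (measurableSet_phaseRegion _ _).inter (measurableSet_magnitudeRegion _ _ _)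

theorem isPositiveChannel_W (hσ : 0 < σ) (hq : IsThresholds b₂ q) :
    IsPositiveChannel fun (y : Fin (2 ^ b₁) × Fin (2 ^ b₂)) u => W σ b₁ b₂ q y.1 y.2 u where
  measurable _ := measurable_receivedLaw_apply σ
    ((measurableSet_phaseRegion _ _).inter (measurableSet_magnitudeRegion _ _ _))
  pos y u := W_pos hσ hq y.1 y.2 u
  sum_eq_one u := sum_W hσ hq u

/-- A bounded magnitude region becomes unlikely when the input is far away. -/
theorem tendsto_W_cobounded (hσ : 0 < σ) (y₁ : Fin (2 ^ b₁)) {y₂ : Fin (2 ^ b₂)}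
    (hy : q y₂.succ ≠ ⊤) :
    Tendsto (W σ b₁ b₂ q y₁ y₂) (Bornology.cobounded ℂ) (𝓝 0) := by
  set r := (q y₂.succ).toReal
  have hlim : Tendsto (fun u : ℂ => 1 - (receivedLaw σ 0).real (Metric.ball 0 (‖u‖ - r)))
      (Bornology.cobounded ℂ) (𝓝 0) := by
    have := ((tendsto_receivedLaw_ball hσ).comp
      (tendsto_atTop_add_const_right _ (-r) (tendsto_norm_cobounded_atTop (E := ℂ)))).const_sub 1
    simpa [sub_eq_add_neg, Function.comp_def] using this
  refine squeeze_zero (fun u => measureReal_nonneg) (fun u => ?_) hlim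
  have := isProbabilityMeasure_receivedLaw hσ u
  -- The cell lies in `|z| < r`, hence outside the ball of radius `|u| - r` around `u`.
  have hball : (receivedLaw σ 0).real (Metric.ball 0 (‖u‖ - r)) =
      (receivedLaw σ u).real (Metric.ball u (‖u‖ - r)) := by
    rw [Measure.real, Measure.real, receivedLaw_ball σ u]
  rw [hball, ← probReal_compl_eq_one_sub measurableSet_ball]
  refine measureReal_mono fun z hz hz' => ?_
  have h1 : ‖z‖ < r := by
    have := (ENNReal.toReal_lt_toReal enorm_ne_top hy).2 hz.2.2
    rwa [toReal_enorm] at this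
  rw [mem_ball_iff_norm'] at hz'
  linarith [norm_sub_norm_le u z]

/-- An outermost region becomes certain when the input moves to infinity inside its sector. -/
theorem exists_tendsto_W_one (hσ : 0 < σ) (hq : IsThresholds b₂ q) (y₁ : Fin (2 ^ b₁))
    {y₂ : Fin (2 ^ b₂)} (hy : q y₂.succ = ⊤) :
    ∃ v : ℕ → ℂ, Tendsto (fun n => W σ b₁ b₂ q y₁ y₂ (v n)) atTop (𝓝 1) := by
  obtain ⟨z, hz, hz1⟩ := exists_mem_openSector b₁ y₁
  obtain ⟨c, hc0, hc⟩ := Metric.isOpen_iff.1 (isOpen_openSector b₁ y₁) z hz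
  -- Radius `c` keeps the ball around `z` in the sector, and `1/2` keeps its points at modulus at
  -- least `1/2`. After dilation by `n ≥ 2q`, with `q` the inner threshold, the ball lies in the
  -- cell.
  set e := min c (1 / 2) with he
  have he0 : 0 < e := lt_min hc0 (by norm_num)
  have hfin : q y₂.castSucc ≠ ⊤ :=
    ((hq.strictMono (Fin.castSucc_lt_succ (i := y₂))).trans_le le_top).ne
  refine ⟨fun n => (n : ℝ) * z, ?_⟩
  have hlim : Tendsto (fun n : ℕ => (receivedLaw σ 0).real (Metric.ball 0 ((n : ℝ) * e))) atTop
      (𝓝 1) :=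
    (tendsto_receivedLaw_ball hσ).comp (tendsto_natCast_atTop_atTop.atTop_mul_const he0)
  refine tendsto_of_tendsto_of_tendsto_of_le_of_le' hlim tendsto_const_nhds ?_ ?_
  · filter_upwards [eventually_ge_atTop 1,
      tendsto_natCast_atTop_atTop.eventually_ge_atTop (2 * (q y₂.castSucc).toReal)] with n hn hnq
    have hn0 : (0 : ℝ) < n := by exact_mod_cast hn
    have := isProbabilityMeasure_receivedLaw hσ ((n : ℝ) * z)
    have hball : (receivedLaw σ 0).real (Metric.ball 0 ((n : ℝ) * e)) =
        (receivedLaw σ ((n : ℝ) * z)).real (Metric.ball ((n : ℝ) * z) ((n : ℝ) * e)) := by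
      rw [Measure.real, Measure.real, receivedLaw_ball σ ((n : ℝ) * z)]
    rw [hball]
    refine measureReal_mono fun x hx => ?_
    have hnC : ((n : ℝ) : ℂ) ≠ 0 := by exact_mod_cast hn0.ne'
    have hxe : x = ((n : ℝ) : ℂ) * (x / (n : ℝ)) := by field_simp
    rw [mem_ball_iff_norm] at hx
    have hnorm : ‖((n : ℝ) : ℂ)‖ = n := by rw [Complex.norm_real, Real.norm_of_nonneg hn0.le]
    have hw : ‖x / (n : ℝ) - z‖ < e := by
      have : x - (n : ℝ) * z = ((n : ℝ) : ℂ) * (x / (n : ℝ) - z) := by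
        rw [mul_sub, ← hxe]
      rw [this, norm_mul, hnorm] at hx
      exact lt_of_mul_lt_mul_left hx hn0.le
    refine ⟨openSector_subset_phaseRegion _ _ ?_, ?_, ?_⟩
    · rw [hxe]
      exact smul_mem_openSector (hc (mem_ball_iff_norm.2 (hw.trans_le (min_le_left _ _)))) hn0
    · have h1 : 1 / 2 ≤ ‖x / (n : ℝ)‖ := by
        have h2 := norm_sub_norm_le z (x / (n : ℝ))
        rw [norm_sub_rev, hz1] at h2
        linarith [min_le_right c (1 / 2)]
      have h3 : (q y₂.castSucc).toReal ≤ ‖x‖ := by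
        rw [hxe, norm_mul, hnorm]
        nlinarith
      rw [← ofReal_norm]
      exact (ENNReal.le_ofReal_iff_toReal_le hfin (norm_nonneg _)).2 h3
    · rw [hy]; exact enorm_lt_top
  · exact Eventually.of_forall fun n => by
      have := isProbabilityMeasure_receivedLaw hσ ((n : ℝ) * z)
      exact measureReal_le_one

/-- Changing the logarithm base and merging the two output indices brings the channel into the
abstract setting; dividing by `log 2` preserves maximizers. -/
theorem mutualInformation_eq (hσ : 0 < σ) (hq : IsThresholds b₂ q) (F : ProbabilityMeasure ℂ) :
    mutualInformation σ b₁ b₂ q F = natInfo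
      (fun (y : Fin (2 ^ b₁) × Fin (2 ^ b₂)) u => W σ b₁ b₂ q y.1 y.2 u) (F : Measure ℂ) /
        Real.log 2 := by
  have hw := isPositiveChannel_W (b₁ := b₁) hσ hq
  have h := hw.integral_relEntropy (F : Measure ℂ) (outputProb
    (fun (y : Fin (2 ^ b₁) × Fin (2 ^ b₂)) u => W σ b₁ b₂ q y.1 y.2 u) (F : Measure ℂ))
  rw [natInfo, ← h, eq_div_iff (Real.log_pos one_lt_two).ne', mutualInformation, outputEntropy,
    conditionalEntropy, sub_neg_eq_add, neg_add_eq_sub]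
  have hl : ∀ x, Real.logb 2 x = Real.log x / Real.log 2 := fun x => rfl
  have h1 : ∀ f g : Fin (2 ^ b₁) → Fin (2 ^ b₂) → ℝ, ∑ y₁, ∑ y₂, f y₁ y₂ * Real.logb 2 (g y₁ y₂) =
      (∑ y : Fin (2 ^ b₁) × Fin (2 ^ b₂), f y.1 y.2 * Real.log (g y.1 y.2)) / Real.log 2 := by
    intro f g
    rw [Fintype.sum_prod_type, Finset.sum_div]
    refine Finset.sum_congr rfl fun i _ => ?_
    rw [Finset.sum_div]
    exact Finset.sum_congr rfl fun j _ => by rw [hl, mul_div_assoc]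
  have hi : Integrable (fun u => ∑ y : Fin (2 ^ b₁) × Fin (2 ^ b₂),
      W σ b₁ b₂ q y.1 y.2 u * Real.log (outputPMF σ b₁ b₂ q F y.1 y.2)) (F : Measure ℂ) :=
    integrable_finsetSum _ fun y _ => (hw.integrable _ y).mul_const _
  have hi' := hw.integrable_negEntropy (F : Measure ℂ)
  simp_rw [h1 _ (outputPMF σ b₁ b₂ q F), h1 _ fun y₁ y₂ => W σ b₁ b₂ q y₁ y₂ _, integral_div]
  rw [← sub_div, div_mul_cancel₀ _ (Real.log_pos one_lt_two).ne']
  exact (integral_sub hi' hi).symm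

end PolarQuantization

end

theorem mainTheorem3 (b₁ b₂ : ℕ) (hb : 0 < b₁ + b₂) (σ : ℝ) (hσ : 0 < σ)
    (q : Fin (2 ^ b₂ + 1) → ENNReal) (hq : PolarQuantization.IsThresholds b₂ q)
    (P' : ℝ) (hP' : 0 ≤ P') (F : MeasureTheory.ProbabilityMeasure ℂ)
    (hF : PolarQuantization.IsCapacityAchieving σ b₁ b₂ q P' F) :
    Bornology.IsBounded (F : MeasureTheory.Measure ℂ).support := by
  obtain ⟨hadm, hcap⟩ := hF
  have hnt : Nontrivial (Fin (2 ^ b₁) × Fin (2 ^ b₂)) := by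
    rw [← Fintype.one_lt_card_iff_nontrivial, Fintype.card_prod, Fintype.card_fin,
      Fintype.card_fin, ← pow_add]
    exact Nat.one_lt_two_pow hb.ne'
  -- Here `L` consists of the cells of the outermost magnitude level, one for each phase.
  refine PolarQuantization.isBounded_support_of_maximal
    (PolarQuantization.isPositiveChannel_W (b₁ := b₁) hσ hq) {y | q y.2.succ = ⊤}
    (fun y hy => PolarQuantization.tendsto_W_cobounded hσ y.1 hy)
    (fun y hy => PolarQuantization.exists_tendsto_W_one hσ hq y.1 hy) hP' F hadm fun G hG hGadm => ?_
  let G' : ProbabilityMeasure ℂ := ⟨G, hG⟩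
  have hle : (PolarQuantization.mutualInformation σ b₁ b₂ q G' : EReal) ≤
      PolarQuantization.mutualInformation σ b₁ b₂ q F := by
    rw [hcap]
    exact le_iSup₂ (f := fun (H : ProbabilityMeasure ℂ)
      (_ : H ∈ PolarQuantization.admissibleInputs P') =>
        (PolarQuantization.mutualInformation σ b₁ b₂ q H : EReal)) G' hGadm
  rw [EReal.coe_le_coe_iff, PolarQuantization.mutualInformation_eq hσ hq,
    PolarQuantization.mutualInformation_eq hσ hq,
    div_le_div_iff_of_pos_right (Real.log_pos one_lt_two)] at hle
  exact hle
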